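/- Let $X$ and $Y$ be locally compact Hausdorff spaces with $X\neq\emptyset$, let $C_0(X)$, $C_0(Y)$ be the algebras of continuous complex-valued functions vanishing at infinity with the supremum norm, let $r>0$, and let $B=B_{C_0(X)}(0;r)$ be the open ball of radius $r$ centred at $0$. For $0<\rho\le r$ write $B_\rho=B_{C_0(X)}(0;\rho)$. Let $H:B\to C_0(Y)$ be a bounded holomorphic map, that is, $\sup_{f\in B}\|H(f)\|<\infty$ and around each point $a\in B$ the map $H$ is the sum of a series $\sum_{n\ge 0}P_n(\cdot-a)$ of bounded $n$-homogeneous polynomials $P_n:C_0(X)\to C_0(Y)$ converging uniformly on some ball centred at $a$. Assume that $H$ is orthogonally additive ($H(f+g)=H(f)+H(g)$ whenever $f,g,f+g\in B$ and $fg=0$) and zero product preserving ($H(f)H(g)=0$ whenever $f,g\in B$ and $fg=0$). Then there are a sequence $(h_n)_{n\ge1}$ of bounded functions $h_n:Y\to\mathbb C$ and a map $\varphi:Y\to X$ such that 1. for every $n\ge1$ the cozero set $\{y\in Y: h_n(y)\ne0\}$ is open in $Y$, and $h_n$ is continuous on it; 2. $\varphi$ is continuous at every $y\in Y$ for which $h_n(y)\neq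 0$ for some $n\ge1$; 3. for all $f\in B$ and all $y\in Y$, $$H(f)(y)=\sum_{n=1}^\infty h_n(y)\,f(\varphi(y))^n,$$ where the series converges absolutely; 4. for every $0<\rho<r$ the convergence is uniform in $(f,y)\in B_\rho\times Y$; and if the Taylor series of $H$ at $0$ (as a series of bounded homogeneous polynomials) converges to $H$ uniformly on the whole ball $B$, then the convergence is uniform in $(f,y)\in B\times Y$. -/

import Mathlib

open Filter Topology
open scoped ZeroAtInfty

/-- A map `Φ`, considered on the set `s`, is orthogonally additive:
`f g = g f = 0` implies `Φ (f + g) = Φ f + Φ g`, for `f`, `g` and `f + g` in `s`. -/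
def OrthogonallyAdditiveOn {A B : Type*} [Mul A] [Zero A] [Add A] [Add B]
    (Φ : A → B) (s : Set A) : Prop :=
  ∀ f ∈ s, ∀ g ∈ s, f + g ∈ s → f * g = 0 → g * f = 0 → Φ (f + g) = Φ f + Φ g

/-- A map `Φ`, considered on the set `s`, is zero product preserving:
`f g = 0` implies `Φ f * Φ g = 0`, for `f` and `g` in `s`. -/
def ZeroProductPreservingOn {A B : Type*} [Mul A] [Zero A] [Mul B] [Zero B]
    (Φ : A → B) (s : Set A) : Prop :=
  ∀ f ∈ s, ∀ g ∈ s, f * g = 0 → Φ f * Φ g = 0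

/-- A map has a Taylor series at zero, i.e. a series of bounded `n`-homogeneous polynomials
`x ↦ p n (x, …, x)`, which converges to it uniformly on the set `s`. -/
def HasUniformTaylorSeriesOn {E F : Type*} [NormedAddCommGroup E] [NormedSpace ℂ E]
    [NormedAddCommGroup F] [NormedSpace ℂ F] (H : E → F) (s : Set E) : Prop :=
  ∃ p : FormalMultilinearSeries ℂ E F,
    TendstoUniformlyOn (fun (N : ℕ) (x : E) => p.partialSum N x) H atTop s

/-! Fix `y`. The Taylor polynomials of `H` at `0`, evaluated at `y`, are scalar polynomials `A n`.
Comparing coefficients on complex lines shows that they are orthogonally additive and that `A n f *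
A m g = 0` whenever `f * g = 0`, for all `n`, `m`. So they should share a one-point support: if no
point supports them all, every point has a neighbourhood on which all of them vanish, and
compactness kills them.

Gluing neighbourhoods is the obstacle, as polynomials do not respect partitions of unity. Instead
`f` is cut along the level `2⁻ᵏ` of a function `ψ` into two orthogonal pieces. The errors live in
disjoint shells, so they form a weakly unconditionally Cauchy series, along which polynomials are
sequentially continuous (`tendsto_diagonal_add`). Hence `A n f` is the limit of the sums over the
two pieces (`tendsto_upperPart_add_lowerPart`). This gives `A n f = c n * f x ^ n`
(`exists_diagonal_eq_mul_pow`), with `x = φ y` and `c n` the value of `h n` at `y`; Cauchy estimates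
give the convergence. -/

/-! ### Homogeneous polynomials along weakly unconditionally Cauchy series. -/

section Multilinear

variable {E : Type*} [NormedAddCommGroup E] [NormedSpace ℂ E]

theorem sum_pow_eq_zero_of_pow_eq_one {k : ℕ} {z : ℂ} (hz : z ^ k = 1) (hz1 : z ≠ 1) :
    ∑ i ∈ Finset.range k, z ^ i = 0 := by
  have h := mul_geom_sum z k
  rw [hz, sub_self] at h
  exact (mul_eq_zero.mp h).resolve_left (sub_ne_zero.mpr hz1)

/-- Averaging a homogeneous polynomial over roots of unity kills its mixed terms. -/
theorem MultilinearMap.sum_diagonal_add_smul {ι : Type*} [Fintype ι] [Nonempty ι]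
    (B : MultilinearMap ℂ (fun _ : ι => E) ℂ) (v l : E) {ζ : ℂ}
    (hζ : IsPrimitiveRoot ζ (Fintype.card ι)) :
    ∑ i ∈ Finset.range (Fintype.card ι), B (fun _ => v + ζ ^ i • l) =
      Fintype.card ι * (B (fun _ => v) + B (fun _ => l)) := by
  classical
  have key : ∀ w : ℂ, B (fun _ => v + w • l) = ∑ s : Finset ι,
      w ^ (sᶜ).card * B (s.piecewise (fun _ => v) (fun _ => l)) := by
    intro w
    have h1 := B.map_add_univ (fun _ => v) (fun _ => w • l)
    rw [show (fun _ : ι => v + w • l) = (fun _ => v) + (fun _ => w • l) from rfl, h1]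
    refine Finset.sum_congr rfl fun s _ => ?_
    have h2 := B.map_piecewise_smul (fun _ => w) (s.piecewise (fun _ => v) (fun _ => l)) sᶜ
    rw [Finset.prod_const, smul_eq_mul] at h2
    rw [← h2]
    congr 1
    ext i
    by_cases hi : i ∈ s <;> simp [hi]
  simp_rw [key]
  rw [Finset.sum_comm]
  simp_rw [← Finset.sum_mul]
  -- A mixed term has degree strictly between `0` and `card ι` in `w`, so its geometric sum runs
  -- over powers of a root of unity other than `1`.
  have hcoef : ∀ s : Finset ι, s ≠ ∅ → s ≠ Finset.univ →
      ∑ i ∈ Finset.range (Fintype.card ι), (ζ ^ i) ^ (sᶜ).card = 0 := by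
    intro s hs hs'
    simp_rw [← pow_mul, mul_comm _ (sᶜ).card, pow_mul]
    apply sum_pow_eq_zero_of_pow_eq_one
    · rw [← pow_mul, mul_comm, pow_mul, hζ.pow_eq_one, one_pow]
    · intro h
      have hd := Nat.le_of_dvd (Finset.card_pos.mpr ?_) (hζ.dvd_of_pow_eq_one _ h)
      · have h3 := Finset.card_compl s
        have h4 := Finset.card_pos.mpr (Finset.nonempty_iff_ne_empty.mpr hs)
        have h5 : 0 < Fintype.card ι := Fintype.card_pos
        omega
      · rw [Finset.nonempty_iff_ne_empty]
        simpa using hs'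
  have hne : (∅ : Finset ι) ≠ Finset.univ := Finset.univ_nonempty.ne_empty.symm
  rw [← Finset.sum_subset (Finset.subset_univ {∅, Finset.univ}), Finset.sum_pair hne]
  · have h0 : ∀ i, (ζ ^ i) ^ (Fintype.card ι) = 1 := fun i => by
      rw [← pow_mul, mul_comm, pow_mul, hζ.pow_eq_one, one_pow]
    simp [h0]
    ring
  · intro s _ hs
    simp only [Finset.mem_insert, Finset.mem_singleton, not_or] at hs
    rw [hcoef s hs.1 hs.2, zero_mul]

theorem Complex.exists_norm_eq_one_norm_add (a b : ℂ) :
    ∃ u : ℂ, ‖u‖ = 1 ∧ ‖a + u * b‖ = ‖a‖ + ‖b‖ := by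
  by_cases ha : a = 0
  · exact ⟨1, by simp, by simp [ha]⟩
  by_cases hb : b = 0
  · exact ⟨1, by simp, by simp [hb]⟩
  have ha' : (‖a‖ : ℂ) ≠ 0 := by simpa using ha
  refine ⟨a / ‖a‖ * (‖b‖ / b), ?_, ?_⟩
  · simp [ha, hb]
  · have h : a + a / ‖a‖ * (‖b‖ / b) * b = a / ‖a‖ * ((‖a‖ + ‖b‖ : ℝ) : ℂ) := by
      push_cast
      field_simp
    rw [h, norm_mul, Complex.norm_real, Real.norm_of_nonneg (by positivity)]
    simp [ha]

/-- Rotate `l` by `c` so that the two diagonal values have the same argument; the average over `ζ ^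
i * c` then has norm equal to the left side, and some term is at least the average. -/
theorem MultilinearMap.exists_norm_diagonal_add_le {ι : Type*} [Fintype ι] [Nonempty ι]
    (B : MultilinearMap ℂ (fun _ : ι => E) ℂ) (v l : E) :
    ∃ w : ℂ, ‖w‖ = 1 ∧ ‖B (fun _ => v)‖ + ‖B (fun _ => l)‖ ≤ ‖B (fun _ => v + w • l)‖ := by
  have hk : 0 < Fintype.card ι := Fintype.card_pos
  obtain ⟨u, hu, hadd⟩ := Complex.exists_norm_eq_one_norm_add (B (fun _ => v)) (B (fun _ => l))
  obtain ⟨c, hc⟩ := IsAlgClosed.exists_pow_nat_eq u hk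
  have hc1 : ‖c‖ = 1 := by
    rw [← pow_eq_one_iff_of_nonneg (norm_nonneg c) hk.ne', ← norm_pow, hc, hu]
  have hζ := Complex.isPrimitiveRoot_exp (Fintype.card ι) hk.ne'
  set ζ := Complex.exp (2 * Real.pi * Complex.I / (Fintype.card ι : ℕ))
  have hζ1 : ‖ζ‖ = 1 := hζ.norm'_eq_one hk.ne'
  have hcl : B (fun _ => c • l) = u * B (fun _ => l) := by
    have h := B.map_smul_univ (fun _ => c) (fun _ => l)
    simpa [hc] using h
  have hsum := B.sum_diagonal_add_smul v (c • l) hζ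
  by_contra! hcon
  have hlt : ‖∑ i ∈ Finset.range (Fintype.card ι), B (fun _ => v + ζ ^ i • c • l)‖ <
      ∑ _i ∈ Finset.range (Fintype.card ι), (‖B (fun _ => v)‖ + ‖B (fun _ => l)‖) := by
    refine (norm_sum_le _ _).trans_lt
      (Finset.sum_lt_sum_of_nonempty (Finset.nonempty_range_iff.mpr hk.ne') fun i _ => ?_)
    have h := hcon (ζ ^ i * c) (by simp [hζ1, hc1])
    simpa [mul_smul] using h
  rw [hsum, hcl, norm_mul, hadd] at hlt
  simp [mul_add] at hlt

/-- Choosing the phases one at a time bounds the sum of the norms by one value of the polynomial on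
a signed partial sum, so the diagonal values are summable. -/
theorem MultilinearMap.tendsto_diagonal_zero {ι : Type*} [Fintype ι] [Nonempty ι]
    (B : MultilinearMap ℂ (fun _ : ι => E) ℂ) {l : ℕ → E} {M C : ℝ}
    (hl : ∀ N, ∀ w : ℕ → ℂ, (∀ i, ‖w i‖ = 1) → ‖∑ i ∈ Finset.range N, w i • l i‖ ≤ M)
    (hB : ∀ x, ‖x‖ ≤ M → ‖B (fun _ => x)‖ ≤ C) :
    Tendsto (fun i => B (fun _ => l i)) atTop (𝓝 0) := by
  have key : ∀ N, ∃ w : ℕ → ℂ, (∀ i, ‖w i‖ = 1) ∧ ∑ i ∈ Finset.range N, ‖B (fun _ => l i)‖ ≤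
      ‖B (fun _ => ∑ i ∈ Finset.range N, w i • l i)‖ := by
    intro N
    induction N with
    | zero => exact ⟨fun _ => 1, by simp, by simp⟩
    | succ N ih =>
      obtain ⟨w, hw, hsum⟩ := ih
      obtain ⟨c, hc, hle⟩ :=
        B.exists_norm_diagonal_add_le (∑ i ∈ Finset.range N, w i • l i) (l N)
      refine ⟨Function.update w N c, fun i => ?_, ?_⟩
      · by_cases hi : i = N
        · subst hi; simpa using hc
        · simpa [hi] using hw i
      · have h : ∑ i ∈ Finset.range N, Function.update w N c i • l i =
            ∑ i ∈ Finset.range N, w i • l i := by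
          refine Finset.sum_congr rfl fun i hi => ?_
          rw [Function.update_of_ne (Finset.mem_range.mp hi).ne]
        rw [Finset.sum_range_succ, Finset.sum_range_succ, h, Function.update_self]
        exact (add_le_add_left hsum _).trans hle
  have hs : Summable fun i => ‖B (fun _ => l i)‖ := by
    refine summable_of_sum_range_le (c := C) (fun _ => norm_nonneg _) fun N => ?_
    obtain ⟨w, hw, hsum⟩ := key N
    exact hsum.trans (hB _ (hl N w hw))
  exact tendsto_zero_iff_norm_tendsto_zero.mpr hs.tendsto_atTop_zero

/-- Continuous homogeneous polynomials are sequentially continuous along weakly unconditionally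
Cauchy series. -/
theorem ContinuousMultilinearMap.tendsto_diagonal_add {n : ℕ}
    (A : ContinuousMultilinearMap ℂ (fun _ : Fin n => E) ℂ) (f : E) {l : ℕ → E} {M : ℝ}
    (hl : ∀ N, ∀ w : ℕ → ℂ, (∀ i, ‖w i‖ = 1) → ‖∑ i ∈ Finset.range N, w i • l i‖ ≤ M) :
    Tendsto (fun i => A (fun _ => f + l i)) atTop (𝓝 (A (fun _ => f))) := by
  classical
  have key : ∀ x, A (fun _ => f + x) = ∑ s : Finset (Fin n),
      A (s.piecewise (fun _ => f) (fun _ => x)) := fun x =>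
    A.toMultilinearMap.map_add_univ (fun _ => f) (fun _ => x)
  simp_rw [key]
  have hlim : A (fun _ => f) = ∑ s : Finset (Fin n), if s = Finset.univ then A (fun _ => f) else 0 := by
    simp
  rw [hlim]
  refine tendsto_finsetSum _ fun s _ => ?_
  by_cases hs : s = Finset.univ
  · subst hs
    simp
  rw [if_neg hs]
  obtain ⟨i₀, hi₀⟩ : ∃ i, i ∉ s := by
    by_contra! h
    exact hs (Finset.eq_univ_iff_forall.mpr h)
  -- Freezing the slots in `s` at `f` leaves a polynomial of positive degree in the other slots.
  let B := A.toMultilinearMap.domDomRestrict (fun i => i ∉ s) (fun _ => f)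
  have hB : ∀ x, B (fun _ => x) = A (s.piecewise (fun _ => f) (fun _ => x)) := by
    intro x
    change A _ = A _
    congr 1
    ext i
    by_cases hi : i ∈ s <;> simp [hi]
  have : Nonempty {i // i ∉ s} := ⟨⟨i₀, hi₀⟩⟩
  have := B.tendsto_diagonal_zero hl (C := ‖A‖ * max ‖f‖ M ^ n) fun x hx => by
    rw [hB]
    refine (A.le_opNorm _).trans (mul_le_mul_of_nonneg_left ?_ (norm_nonneg _))
    refine (Finset.prod_le_prod (g := fun _ => max ‖f‖ M) (fun _ _ => norm_nonneg _)
      fun i _ => ?_).trans (by simp)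
    by_cases hi : i ∈ s
    · simp [hi]
    · simp [hi, hx]
  simpa only [hB] using this

end Multilinear

/-! ### Cutting functions along level sets. -/

section ZeroAtInfty

variable {X : Type*} [TopologicalSpace X]

namespace ZeroAtInftyContinuousMap

theorem norm_apply_le (f : C₀(X, ℂ)) (x : X) : ‖f x‖ ≤ ‖f‖ :=
  f.toBCF.norm_coe_le_norm x

theorem norm_le_of_forall {f : C₀(X, ℂ)} {C : ℝ} (hC : 0 ≤ C) (h : ∀ x, ‖f x‖ ≤ C) : ‖f‖ ≤ C :=
  (BoundedContinuousFunction.norm_le (f := f.toBCF) hC).mpr h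

/-- Evaluation at a point. -/
noncomputable def evalCLM (x : X) : C₀(X, ℂ) →L[ℂ] ℂ :=
  LinearMap.mkContinuous
    { toFun := fun f => f x
      map_add' := fun _ _ => rfl
      map_smul' := fun _ _ => rfl }
    1 fun f => by simpa using f.norm_apply_le x

/-- Multiplication by a continuous function with values in the unit interval. -/
noncomputable def mulReal (f : C₀(X, ℂ)) (g : C(X, ℝ)) (hg : ∀ x, g x ∈ Set.Icc (0 : ℝ) 1) :
    C₀(X, ℂ) where
  toFun x := (g x : ℂ) * f x
  continuous_toFun := by fun_prop
  zero_at_infty' := by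
    refine squeeze_zero_norm (a := fun x => ‖f x‖) (fun x => ?_) ?_
    · rw [norm_mul, Complex.norm_real, Real.norm_of_nonneg (hg x).1]
      exact mul_le_of_le_one_left (norm_nonneg _) (hg x).2
    · simpa using (f.zero_at_infty').norm

end ZeroAtInftyContinuousMap

/-- The ramp which is `0` up to `m` and `1` from `5 * m / 4` on. -/
noncomputable def upperRamp (m t : ℝ) : ℝ := max 0 (min 1 (4 * (t - m) / m))

/-- The ramp which is `1` up to `3 * m / 4` and `0` from `m` on. -/
noncomputable def lowerRamp (m t : ℝ) : ℝ := max 0 (min 1 (4 * (m - t) / m))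

theorem upperRamp_mem (m t : ℝ) : upperRamp m t ∈ Set.Icc (0 : ℝ) 1 := by
  simp [upperRamp]

theorem lowerRamp_mem (m t : ℝ) : lowerRamp m t ∈ Set.Icc (0 : ℝ) 1 := by
  simp [lowerRamp]

theorem continuous_upperRamp (m : ℝ) : Continuous (upperRamp m) := by
  unfold upperRamp; fun_prop

theorem continuous_lowerRamp (m : ℝ) : Continuous (lowerRamp m) := by
  unfold lowerRamp; fun_prop

theorem upperRamp_eq_zero {m t : ℝ} (hm : 0 < m) (h : t ≤ m) : upperRamp m t = 0 :=
  max_eq_left ((min_le_right _ _).trans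
    (div_nonpos_of_nonpos_of_nonneg (by linarith) hm.le))

theorem lowerRamp_eq_zero {m t : ℝ} (hm : 0 < m) (h : m ≤ t) : lowerRamp m t = 0 :=
  max_eq_left ((min_le_right _ _).trans
    (div_nonpos_of_nonpos_of_nonneg (by linarith) hm.le))

theorem upperRamp_eq_one {m t : ℝ} (hm : 0 < m) (h : 5 / 4 * m ≤ t) : upperRamp m t = 1 := by
  have : 1 ≤ 4 * (t - m) / m := by rw [le_div_iff₀ hm]; linarith
  rw [upperRamp, min_eq_left this, max_eq_right zero_le_one]

theorem lowerRamp_eq_one {m t : ℝ} (hm : 0 < m) (h : t ≤ 3 / 4 * m) : lowerRamp m t = 1 := by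
  have : 1 ≤ 4 * (m - t) / m := by rw [le_div_iff₀ hm]; linarith
  rw [lowerRamp, min_eq_left this, max_eq_right zero_le_one]

theorem abs_ramps_sub_one_le {m : ℝ} (hm : 0 < m) (t : ℝ) :
    |upperRamp m t + lowerRamp m t - 1| ≤ 1 := by
  have h1 := upperRamp_mem m t
  have h2 := lowerRamp_mem m t
  rcases le_total t m with h | h
  · rw [upperRamp_eq_zero hm h, abs_le]
    constructor <;> linarith [h2.1, h2.2]
  · rw [lowerRamp_eq_zero hm h, abs_le]
    constructor <;> linarith [h1.1, h1.2]

theorem mem_Ioo_of_ramps_ne_one {m t : ℝ} (hm : 0 < m)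
    (h : upperRamp m t + lowerRamp m t - 1 ≠ 0) : t ∈ Set.Ioo (3 / 4 * m) (5 / 4 * m) := by
  constructor <;> by_contra! hcon <;> apply h
  · rw [lowerRamp_eq_one hm hcon, upperRamp_eq_zero hm (by linarith)]; ring
  · rw [upperRamp_eq_one hm hcon, lowerRamp_eq_zero hm (by linarith)]; ring

/-- The shells are disjoint: for `i < j`, `5/4 * 2⁻ʲ ≤ 5/8 * 2⁻ⁱ < 3/4 * 2⁻ⁱ`. -/
theorem eq_of_ramps_ne_one {i j : ℕ} {t : ℝ}
    (hi : upperRamp ((1 / 2) ^ i) t + lowerRamp ((1 / 2) ^ i) t - 1 ≠ 0)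
    (hj : upperRamp ((1 / 2) ^ j) t + lowerRamp ((1 / 2) ^ j) t - 1 ≠ 0) : i = j := by
  wlog hij : i < j generalizing i j
  · rcases lt_trichotomy i j with h | h | h
    · exact this hi hj h
    · exact h
    · exact (this hj hi h).symm
  have h1 := (mem_Ioo_of_ramps_ne_one (by positivity) hi).1
  have h2 := (mem_Ioo_of_ramps_ne_one (by positivity) hj).2
  have h3 : ((1 : ℝ) / 2) ^ j ≤ (1 / 2) ^ (i + 1) :=
    pow_le_pow_of_le_one (by norm_num) (by norm_num) hij
  have h4 : (0 : ℝ) < (1 / 2) ^ i := by positivity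
  rw [pow_succ] at h3
  linarith

namespace ZeroAtInftyContinuousMap

/-- The part of `f` where `ψ` is above the level `m`. -/
noncomputable def upperPart (f : C₀(X, ℂ)) (ψ : C(X, ℝ)) (m : ℝ) : C₀(X, ℂ) :=
  f.mulReal ⟨fun x => upperRamp m (ψ x), (continuous_upperRamp m).comp ψ.continuous⟩
    fun x => upperRamp_mem m (ψ x)

/-- The part of `f` where `ψ` is below the level `m`. -/
noncomputable def lowerPart (f : C₀(X, ℂ)) (ψ : C(X, ℝ)) (m : ℝ) : C₀(X, ℂ) :=
  f.mulReal ⟨fun x => lowerRamp m (ψ x), (continuous_lowerRamp m).comp ψ.continuous⟩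
    fun x => lowerRamp_mem m (ψ x)

@[simp] theorem upperPart_apply (f : C₀(X, ℂ)) (ψ : C(X, ℝ)) (m : ℝ) (x : X) :
    f.upperPart ψ m x = (upperRamp m (ψ x) : ℂ) * f x := rfl

@[simp] theorem lowerPart_apply (f : C₀(X, ℂ)) (ψ : C(X, ℝ)) (m : ℝ) (x : X) :
    f.lowerPart ψ m x = (lowerRamp m (ψ x) : ℂ) * f x := rfl

theorem upperPart_mul_lowerPart (f : C₀(X, ℂ)) (ψ : C(X, ℝ)) {m : ℝ} (hm : 0 < m) :
    f.upperPart ψ m * f.lowerPart ψ m = 0 := by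
  ext x
  rcases le_total (ψ x) m with h | h
  · simp [upperRamp_eq_zero hm h]
  · simp [lowerRamp_eq_zero hm h]

/-- A continuous orthogonally additive polynomial splits along a level of `ψ`, in the limit. -/
theorem tendsto_upperPart_add_lowerPart {n : ℕ}
    {A : ContinuousMultilinearMap ℂ (fun _ : Fin n => C₀(X, ℂ)) ℂ}
    (hA : ∀ f g : C₀(X, ℂ), f * g = 0 → A (fun _ => f + g) = A (fun _ => f) + A (fun _ => g))
    (f : C₀(X, ℂ)) (ψ : C(X, ℝ)) :
    Tendsto (fun k : ℕ => A (fun _ => f.upperPart ψ ((1 / 2) ^ k)) +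
      A (fun _ => f.lowerPart ψ ((1 / 2) ^ k))) atTop (𝓝 (A (fun _ => f))) := by
  let l : ℕ → C₀(X, ℂ) := fun k =>
    f.upperPart ψ ((1 / 2) ^ k) + f.lowerPart ψ ((1 / 2) ^ k) - f
  have hlx : ∀ k x, l k x = ((upperRamp ((1 / 2) ^ k) (ψ x) +
      lowerRamp ((1 / 2) ^ k) (ψ x) - 1 : ℝ) : ℂ) * f x := by
    intro k x
    simp only [l, sub_apply, add_apply, upperPart_apply, lowerPart_apply]
    push_cast
    ring
  have hl : ∀ N, ∀ w : ℕ → ℂ, (∀ i, ‖w i‖ = 1) → ‖∑ i ∈ Finset.range N, w i • l i‖ ≤ ‖f‖ := by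
    intro N w hw
    refine norm_le_of_forall (norm_nonneg _) fun x => ?_
    have hsum : (∑ i ∈ Finset.range N, w i • l i) x = ∑ i ∈ Finset.range N, w i * l i x := by
      exact map_sum (evalCLM x) (fun i => w i • l i) (Finset.range N)
    rw [hsum]
    -- At each point at most one error is nonzero, so the bound does not grow with `N`.
    by_cases h : ∃ i ∈ Finset.range N, l i x ≠ 0
    · obtain ⟨i, hi, hix⟩ := h
      rw [Finset.sum_eq_single_of_mem i hi, norm_mul, hw, one_mul, hlx, norm_mul,
        Complex.norm_real]
      · exact (mul_le_of_le_one_left (norm_nonneg _)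
          (abs_ramps_sub_one_le (by positivity) _)).trans (f.norm_apply_le x)
      · intro j _ hji
        by_contra hj
        apply hji
        have hj' : l j x ≠ 0 := right_ne_zero_of_mul hj
        rw [hlx] at hix hj'
        exact eq_of_ramps_ne_one (Complex.ofReal_ne_zero.mp (left_ne_zero_of_mul hj'))
          (Complex.ofReal_ne_zero.mp (left_ne_zero_of_mul hix))
    · push Not at h
      rw [Finset.sum_eq_zero fun i hi => by rw [h i hi, mul_zero]]
      simp
  refine (A.tendsto_diagonal_add f hl).congr fun k => ?_
  rw [← hA _ _ (f.upperPart_mul_lowerPart ψ (by positivity))]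
  congr 1
  ext1
  simp [l]

/-- Truncation where `f` is small. -/
theorem exists_norm_sub_le_of_norm_le (f : C₀(X, ℂ)) {ε : ℝ} (hε : 0 < ε) :
    ∃ g : C₀(X, ℂ), ‖f - g‖ ≤ 2 * ε ∧ ∀ x, ‖f x‖ ≤ ε → g x = 0 := by
  refine ⟨f.upperPart ⟨fun x => ‖f x‖, by fun_prop⟩ ε, ?_, fun x hx => ?_⟩
  · refine norm_le_of_forall (by positivity) fun x => ?_
    have h : (f - f.upperPart ⟨fun x => ‖f x‖, by fun_prop⟩ ε) x =
        ((1 - upperRamp ε ‖f x‖ : ℝ) : ℂ) * f x := by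
      simp [sub_mul]
    rw [h, norm_mul, Complex.norm_real]
    rcases le_total (5 / 4 * ε) ‖f x‖ with hx | hx
    · rw [upperRamp_eq_one hε hx]
      simp [hε.le]
    · have := upperRamp_mem ε ‖f x‖
      rw [Real.norm_of_nonneg (by linarith [this.2])]
      refine (mul_le_of_le_one_left (norm_nonneg _) (by linarith [this.1])).trans (by linarith)
  · simp [upperRamp_eq_zero hε hx]

/-- Used twice: to reduce to functions living on a compact set, and to approximate a function with a
zero at `x` by functions vanishing near `x`. -/
theorem exists_tendsto_of_norm_le (f : C₀(X, ℂ)) :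
    ∃ g : ℕ → C₀(X, ℂ), Tendsto g atTop (𝓝 f) ∧
      ∀ k, ∃ ε > 0, ∀ x, ‖f x‖ ≤ ε → g k x = 0 := by
  choose g hg hg0 using fun k : ℕ =>
    f.exists_norm_sub_le_of_norm_le (ε := (1 / 2) ^ k) (by positivity)
  refine ⟨g, ?_, fun k => ⟨_, by positivity, hg0 k⟩⟩
  rw [tendsto_iff_norm_sub_tendsto_zero]
  have h0 : Tendsto (fun k : ℕ => 2 * ((1 : ℝ) / 2) ^ k) atTop (𝓝 0) := by
    simpa using (tendsto_pow_atTop_nhds_zero_of_lt_one (r := (1 : ℝ) / 2)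
      (by norm_num) (by norm_num)).const_mul 2
  exact squeeze_zero (fun _ => norm_nonneg _) (fun k => by rw [norm_sub_rev]; exact hg k) h0

end ZeroAtInftyContinuousMap

end ZeroAtInfty

/-! ### Polynomials supported at one point. -/

section PointEvaluation

variable {X : Type*} [TopologicalSpace X] [LocallyCompactSpace X] [T2Space X]

theorem ZeroAtInftyContinuousMap.exists_one_on_compact {K U : Set X} (hK : IsCompact K)
    (hU : IsOpen U) (hKU : K ⊆ U) :
    ∃ e : C₀(X, ℂ), (∀ x ∈ K, e x = 1) ∧ (∀ x ∉ U, e x = 0) ∧ ‖e‖ ≤ 1 := by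
  obtain ⟨g, hg1, hg0, hgc, hg⟩ := exists_continuous_one_zero_of_isCompact hK hU.isClosed_compl
    (Set.disjoint_compl_right_iff_subset.mpr hKU)
  have hc : HasCompactSupport fun x => (g x : ℂ) := hgc.comp_left Complex.ofReal_zero
  refine ⟨⟨⟨fun x => (g x : ℂ), by fun_prop⟩, hc.is_zero_at_infty⟩, fun x hx => ?_,
    fun x hx => ?_, norm_le_of_forall zero_le_one fun x => ?_⟩
  · change (g x : ℂ) = 1
    simp [hg1 hx]
  · change (g x : ℂ) = 0
    have := hg0 hx
    simp [this]
  · change ‖(g x : ℂ)‖ ≤ 1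
    rw [Complex.norm_real, Real.norm_of_nonneg (hg x).1]
    exact (hg x).2

theorem ZeroAtInftyContinuousMap.exists_eventuallyEq_one {x : X} {U : Set X} (hU : U ∈ 𝓝 x) :
    ∃ e : C₀(X, ℂ), (∀ᶠ z in 𝓝 x, e z = 1) ∧ (∀ z ∉ U, e z = 0) ∧ ‖e‖ ≤ 1 := by
  obtain ⟨V, hVU, hV, hxV⟩ := mem_nhds_iff.mp hU
  obtain ⟨K, hK, hxK, hKV⟩ := exists_compact_subset hV hxV
  obtain ⟨e, he1, he0, he⟩ := exists_one_on_compact hK hV hKV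
  exact ⟨e, by filter_upwards [mem_interior_iff_mem_nhds.mp hxK] using he1,
    fun z hz => he0 z fun h => hz (hVU h), he⟩

variable {A : (n : ℕ) → ContinuousMultilinearMap ℂ (fun _ : Fin n => C₀(X, ℂ)) ℂ}

/-- The union of two neighbourhoods on which orthogonally additive polynomials vanish. -/
theorem exists_isOpen_union_diagonal_eq_zero
    (hA : ∀ n, ∀ f g : C₀(X, ℂ), f * g = 0 →
      A n (fun _ => f + g) = A n (fun _ => f) + A n (fun _ => g))
    {K₁ K₂ U₁ U₂ : Set X} (hK₁ : IsCompact K₁) (hU₁ : IsOpen U₁) (hU₂ : IsOpen U₂)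
    (h₁ : K₁ ⊆ U₁) (h₂ : K₂ ⊆ U₂)
    (hz₁ : ∀ f : C₀(X, ℂ), (∀ x ∉ U₁, f x = 0) → ∀ n, A n (fun _ => f) = 0)
    (hz₂ : ∀ f : C₀(X, ℂ), (∀ x ∉ U₂, f x = 0) → ∀ n, A n (fun _ => f) = 0) :
    ∃ U, IsOpen U ∧ K₁ ∪ K₂ ⊆ U ∧
      ∀ f : C₀(X, ℂ), (∀ x ∉ U, f x = 0) → ∀ n, A n (fun _ => f) = 0 := by
  obtain ⟨g, hg1, hg0, -⟩ := exists_continuous_one_zero_of_isCompact hK₁ hU₁.isClosed_compl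
    (Set.disjoint_compl_right_iff_subset.mpr h₁)
  -- The factor `2` puts `K₁` strictly above every level `2⁻ᵏ ≤ 1`. The upper part of `f` then
  -- vanishes off `U₁`, the lower part off `U₂`.
  let ψ : C(X, ℝ) := ⟨fun x => 2 * g x, by fun_prop⟩
  refine ⟨{x | 1 < ψ x} ∪ U₂, (isOpen_lt continuous_const ψ.continuous).union hU₂,
    Set.union_subset_union (fun x hx => ?_) h₂, fun f hf n => ?_⟩
  · have : g x = 1 := hg1 hx
    simp [ψ, this]
  · have h := ZeroAtInftyContinuousMap.tendsto_upperPart_add_lowerPart (hA n) f ψ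
    refine tendsto_nhds_unique h ?_
    rw [tendsto_congr fun k => ?_]
    · exact tendsto_const_nhds
    have hm : (0 : ℝ) < (1 / 2) ^ k := by positivity
    have hm1 : ((1 : ℝ) / 2) ^ k ≤ 1 := pow_le_one₀ (by norm_num) (by norm_num)
    rw [hz₁ _ fun x hx => ?_, hz₂ _ fun x hx => ?_, add_zero]
    · by_cases hψ : 1 < ψ x
      · rw [ZeroAtInftyContinuousMap.lowerPart_apply,
          lowerRamp_eq_zero hm (hm1.trans hψ.le), Complex.ofReal_zero, zero_mul]
      · simp [hf x (by simp [hx, not_lt.mp hψ])]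
    · have : g x = 0 := hg0 hx
      have hψ : ψ x ≤ (1 / 2) ^ k := by simp [ψ, this]
      rw [ZeroAtInftyContinuousMap.upperPart_apply, upperRamp_eq_zero hm hψ, Complex.ofReal_zero,
        zero_mul]

/-- Orthogonally additive polynomials with zero products on orthogonal functions are supported
at a point. -/
theorem exists_forall_diagonal_eq_zero_of_eventuallyEq [Nonempty X]
    (hA : ∀ n, ∀ f g : C₀(X, ℂ), f * g = 0 →
      A n (fun _ => f + g) = A n (fun _ => f) + A n (fun _ => g))
    (hmul : ∀ n m, ∀ f g : C₀(X, ℂ), f * g = 0 → A n (fun _ => f) * A m (fun _ => g) = 0) :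
    ∃ x : X, ∀ n, ∀ f : C₀(X, ℂ), (∀ᶠ z in 𝓝 x, f z = 0) → A n (fun _ => f) = 0 := by
  by_contra! hcon
  have hloc : ∀ x, ∃ U, IsOpen U ∧ x ∈ U ∧
      ∀ f : C₀(X, ℂ), (∀ z ∉ U, f z = 0) → ∀ n, A n (fun _ => f) = 0 := by
    intro x
    obtain ⟨n, f, hf, hne⟩ := hcon x
    obtain ⟨U, hU, hUo, hxU⟩ := eventually_nhds_iff.mp hf
    refine ⟨U, hUo, hxU, fun g hg m => (mul_eq_zero.mp (hmul n m f g ?_)).resolve_left hne⟩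
    ext z
    by_cases hz : z ∈ U
    · simp [hU z hz]
    · simp [hg z hz]
  have hcomp : ∀ K : Set X, IsCompact K → ∃ U, IsOpen U ∧ K ⊆ U ∧
      ∀ f : C₀(X, ℂ), (∀ z ∉ U, f z = 0) → ∀ n, A n (fun _ => f) = 0 := by
    -- The intermediate compact `L` is needed because the induction passes through arbitrary sets,
    -- while gluing requires compact ones.
    have hP : ∀ K : Set X, IsCompact K → ∃ L, IsCompact L ∧ K ⊆ L ∧ ∃ U, IsOpen U ∧ L ⊆ U ∧
        ∀ f : C₀(X, ℂ), (∀ z ∉ U, f z = 0) → ∀ n, A n (fun _ => f) = 0 := by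
      intro K hK
      refine hK.induction_on ?_ ?_ ?_ ?_
      · refine ⟨∅, isCompact_empty, subset_rfl, ∅, isOpen_empty, subset_rfl, fun f hf n => ?_⟩
        have hf0 : f = 0 := by ext z; exact hf z (Set.notMem_empty z)
        have h := hA n 0 0 (by simp)
        rw [hf0]
        simpa using h
      · rintro s t hst ⟨L, hL, htL, h⟩
        exact ⟨L, hL, hst.trans htL, h⟩
      · rintro s t ⟨L₁, hL₁, hsL, U₁, hU₁, hLU₁, h₁⟩ ⟨L₂, hL₂, htL, U₂, hU₂, hLU₂, h₂⟩
        obtain h := exists_isOpen_union_diagonal_eq_zero hA hL₁ hU₁ hU₂ hLU₁ hLU₂ h₁ h₂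
        exact ⟨L₁ ∪ L₂, hL₁.union hL₂, Set.union_subset_union hsL htL, h⟩
      · intro x _
        obtain ⟨U, hU, hxU, h⟩ := hloc x
        obtain ⟨L, hL, hxL, hLU⟩ := exists_compact_subset hU hxU
        exact ⟨L, mem_nhdsWithin_of_mem_nhds (mem_interior_iff_mem_nhds.mp hxL), L, hL,
          subset_rfl, U, hU, hLU, h⟩
    intro K hK
    obtain ⟨L, -, hKL, U, hU, hLU, h⟩ := hP K hK
    exact ⟨U, hU, hKL.trans hLU, h⟩
  obtain ⟨n, f, -, hne⟩ := hcon (Classical.arbitrary X)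
  obtain ⟨g, hg, hg0⟩ := f.exists_tendsto_of_norm_le
  apply hne
  have hcont : Continuous fun f : C₀(X, ℂ) => A n (fun _ => f) := by fun_prop
  refine tendsto_nhds_unique ((hcont.tendsto f).comp hg) ?_
  rw [tendsto_congr fun k => ?_]
  · exact tendsto_const_nhds
  obtain ⟨ε, hε, hk⟩ := hg0 k
  have hf0 : ∀ᶠ x in cocompact X, ‖f x‖ < ε := by
    have h0 : Tendsto (fun x => ‖f x‖) (cocompact X) (𝓝 0) := by
      simpa using f.zero_at_infty'.norm
    exact h0.eventually (gt_mem_nhds hε)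
  obtain ⟨K, hK, hKf⟩ := mem_cocompact.mp hf0
  obtain ⟨U, -, hKU, hz⟩ := hcomp K hK
  exact hz _ (fun z hz => hk z (hKf (fun h => hz (hKU h))).le) n

/-- Orthogonally additive polynomials with zero products on orthogonal functions are multiples of
powers of one evaluation. -/
theorem exists_diagonal_eq_mul_pow [Nonempty X]
    (hA : ∀ n, ∀ f g : C₀(X, ℂ), f * g = 0 →
      A n (fun _ => f + g) = A n (fun _ => f) + A n (fun _ => g))
    (hmul : ∀ n m, ∀ f g : C₀(X, ℂ), f * g = 0 → A n (fun _ => f) * A m (fun _ => g) = 0) :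
    ∃ (x : X) (c : ℕ → ℂ), ∀ n, ∀ f : C₀(X, ℂ), A n (fun _ => f) = c n * f x ^ n := by
  obtain ⟨x, hx⟩ := exists_forall_diagonal_eq_zero_of_eventuallyEq hA hmul
  -- Only the germ at `x` matters: the lower parts vanish near `x`, and the upper parts of `f` and
  -- `g` coincide.
  have hloc : ∀ n, ∀ f g : C₀(X, ℂ), (∀ᶠ z in 𝓝 x, f z = g z) →
      A n (fun _ => f) = A n (fun _ => g) := by
    intro n f g hfg
    obtain ⟨U, hU, hUo, hxU⟩ := eventually_nhds_iff.mp hfg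
    obtain ⟨e, he1, he0, -⟩ := exists_continuous_one_zero_of_isCompact isCompact_singleton
      hUo.isClosed_compl (Set.disjoint_compl_right_iff_subset.mpr (Set.singleton_subset_iff.mpr hxU))
    let ψ : C(X, ℝ) := ⟨fun x => 2 * e x, by fun_prop⟩
    have hψx : ∀ᶠ z in 𝓝 x, 1 < ψ z := by
      refine (ψ.continuous.tendsto x).eventually (lt_mem_nhds ?_)
      have : e x = 1 := he1 rfl
      simp [ψ, this]
    have hlow : ∀ (f : C₀(X, ℂ)) (k : ℕ), A n (fun _ => f.lowerPart ψ ((1 / 2) ^ k)) = 0 := by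
      intro f k
      refine hx n _ (hψx.mono fun z hz => ?_)
      have hm1 : ((1 : ℝ) / 2) ^ k ≤ 1 := pow_le_one₀ (by norm_num) (by norm_num)
      rw [ZeroAtInftyContinuousMap.lowerPart_apply, lowerRamp_eq_zero (by positivity) (hm1.trans hz.le),
        Complex.ofReal_zero, zero_mul]
    have hup : ∀ k : ℕ, f.upperPart ψ ((1 / 2) ^ k) = g.upperPart ψ ((1 / 2) ^ k) := by
      intro k
      ext z
      by_cases hz : z ∈ U
      · simp [hU z hz]
      · have : e z = 0 := he0 hz
        have hψ : ψ z ≤ (1 / 2) ^ k := by simp [ψ, this]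
        rw [ZeroAtInftyContinuousMap.upperPart_apply, ZeroAtInftyContinuousMap.upperPart_apply,
          upperRamp_eq_zero (by positivity) hψ, Complex.ofReal_zero, zero_mul, zero_mul]
    have h1 := ZeroAtInftyContinuousMap.tendsto_upperPart_add_lowerPart (hA n) f ψ
    have h2 := ZeroAtInftyContinuousMap.tendsto_upperPart_add_lowerPart (hA n) g ψ
    simp only [hlow, hup] at h1 h2
    exact tendsto_nhds_unique h1 h2
  -- From germs to values: `f - g` is a limit of functions vanishing near `x`.
  have hval : ∀ n, ∀ f g : C₀(X, ℂ), f x = g x → A n (fun _ => f) = A n (fun _ => g) := by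
    intro n f g hfg
    obtain ⟨d, hd, hd0⟩ := (f - g).exists_tendsto_of_norm_le
    have hcont : Continuous fun d : C₀(X, ℂ) => A n (fun _ => g + d) := by fun_prop
    have h1 := (hcont.tendsto (f - g)).comp hd
    rw [add_sub_cancel] at h1
    refine tendsto_nhds_unique h1 ?_
    rw [tendsto_congr fun k => ?_]
    · exact tendsto_const_nhds
    obtain ⟨ε, hε, hk⟩ := hd0 k
    have h0 : Tendsto (fun z => ‖(f - g) z‖) (𝓝 x) (𝓝 0) := by
      have : Continuous fun z => ‖(f - g) z‖ := by fun_prop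
      simpa [hfg] using this.tendsto x
    refine hloc n _ _ ((h0.eventually (gt_mem_nhds hε)).mono fun z hz => ?_)
    simp [hk z hz.le]
  obtain ⟨e, he, -⟩ :=
    ZeroAtInftyContinuousMap.exists_eventuallyEq_one (univ_mem : Set.univ ∈ 𝓝 x)
  refine ⟨x, fun n => A n (fun _ => e), fun n f => ?_⟩
  rw [hval n f (f x • e) (by simp [he.self_of_nhds])]
  have h := (A n).map_smul_univ (fun _ => f x) (fun _ => e)
  simpa [mul_comm] using h

end PointEvaluation

/-! ### Taylor polynomials through restriction to complex lines. -/

section Taylor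

variable {E F : Type*} [NormedAddCommGroup E] [NormedSpace ℂ E]
  [NormedAddCommGroup F] [NormedSpace ℂ F] {H : E → F} {p : FormalMultilinearSeries ℂ E F}

namespace FormalMultilinearSeries

/-- The restriction of a series to the line spanned by `f`. -/
noncomputable def slice (p : FormalMultilinearSeries ℂ E F) (f : E) :
    FormalMultilinearSeries ℂ ℂ F :=
  p.compContinuousLinearMap (ContinuousLinearMap.toSpanSingleton ℂ f)

theorem slice_apply_diagonal (p : FormalMultilinearSeries ℂ E F) (f : E) (n : ℕ) (z : ℂ) :
    p.slice f n (fun _ => z) = p n (fun _ => z • f) := rfl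

theorem slice_apply_one (p : FormalMultilinearSeries ℂ E F) (f : E) (n : ℕ) :
    p.slice f n (fun _ => 1) = p n (fun _ => f) := by
  rw [slice_apply_diagonal, one_smul]

@[simp] theorem coeff_slice (p : FormalMultilinearSeries ℂ E F) (f : E) (n : ℕ) :
    (p.slice f).coeff n = p n (fun _ => f) :=
  p.slice_apply_one f n

theorem norm_slice (p : FormalMultilinearSeries ℂ E F) (f : E) (n : ℕ) :
    ‖p.slice f n‖ = ‖p n (fun _ => f)‖ := by
  rw [← coeff_slice, norm_apply_eq_norm_coef]

end FormalMultilinearSeries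

theorem HasFPowerSeriesAt.slice (hp : HasFPowerSeriesAt H p 0) (f : E) :
    HasFPowerSeriesAt (fun z : ℂ => H (z • f)) (p.slice f) 0 := by
  have h : HasFPowerSeriesAt H p (ContinuousLinearMap.toSpanSingleton ℂ f 0) := by simpa using hp
  exact h.compContinuousLinearMap

theorem HasFPowerSeriesAt.diagonal_eq_of_slice (hp : HasFPowerSeriesAt H p 0) {f : E}
    {q : FormalMultilinearSeries ℂ ℂ F} (hq : HasFPowerSeriesAt (fun z : ℂ => H (z • f)) q 0)
    (n : ℕ) : p n (fun _ => f) = q n (fun _ => 1) := by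
  rw [← p.slice_apply_one, (hp.slice f).eq_formalMultilinearSeries hq]

theorem eventually_smul_mem_ball (f : E) {r : ℝ} (hr : 0 < r) :
    ∀ᶠ z : ℂ in 𝓝 0, z • f ∈ Metric.ball (0 : E) r := by
  have h : Continuous fun z : ℂ => z • f := by fun_prop
  exact (h.tendsto' 0 0 (by simp)).eventually (Metric.ball_mem_nhds 0 hr)

/-- Cauchy estimates for the Taylor polynomials of a bounded analytic map. -/
theorem HasFPowerSeriesAt.hasSum_and_norm_diagonal_le [CompleteSpace F]
    (hp : HasFPowerSeriesAt H p 0) {r C R : ℝ} (hH : AnalyticOnNhd ℂ H (Metric.ball 0 r))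
    (hC : ∀ x ∈ Metric.ball (0 : E) r, ‖H x‖ ≤ C) (hR : 1 < R) {f : E} (hf : R * ‖f‖ < r) :
    HasSum (fun n => p n (fun _ => f)) (H f) ∧ ∀ n, ‖p n (fun _ => f)‖ ≤ C * R⁻¹ ^ n := by
  lift R to NNReal using by linarith
  have hR0 : (0 : ℝ) < R := by linarith
  have hmem : ∀ z ∈ Metric.closedBall (0 : ℂ) R, z • f ∈ Metric.ball (0 : E) r := by
    intro z hz
    rw [mem_closedBall_zero_iff] at hz
    rw [mem_ball_zero_iff, norm_smul]
    exact (mul_le_mul_of_nonneg_right hz (norm_nonneg f)).trans_lt hf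
  have hd : DifferentiableOn ℂ (fun z : ℂ => H (z • f)) (Metric.closedBall 0 R) := fun z hz =>
    ((hH _ (hmem z hz)).differentiableAt.comp z
      (by fun_prop : DifferentiableAt ℂ (fun z : ℂ => z • f) z)).differentiableWithinAt
  have hb := hd.hasFPowerSeriesOnBall (by exact_mod_cast hR0)
  have heq := (hp.slice f).eq_formalMultilinearSeries hb.hasFPowerSeriesAt
  rw [← heq] at hb
  constructor
  · have h1 := hb.hasSum (y := 1) (by simpa using hR)
    simpa using h1
  · intro n
    rw [← p.norm_slice, heq]
    refine (norm_cauchyPowerSeries_le _ _ _ _).trans ?_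
    rw [abs_of_pos hR0]
    refine mul_le_mul_of_nonneg_right ?_ (by positivity)
    have hint := intervalIntegral.norm_integral_le_of_norm_le_const (a := 0) (b := 2 * Real.pi)
      (C := C) (f := fun θ : ℝ => ‖H (circleMap 0 R θ • f)‖) fun θ _ => by
        rw [norm_norm]
        exact hC _ (hmem _ (circleMap_mem_closedBall 0 hR0.le θ))
    rw [sub_zero, abs_of_pos Real.two_pi_pos] at hint
    have h2 := (Real.le_norm_self _).trans hint
    rw [inv_mul_le_iff₀ Real.two_pi_pos]
    linarith

/-- A pointwise convergent Taylor series is unique. -/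
theorem HasFPowerSeriesAt.diagonal_eq_of_tendsto [CompleteSpace F] (hp : HasFPowerSeriesAt H p 0)
    {q : FormalMultilinearSeries ℂ E F} {r : ℝ}
    (hq : ∀ x ∈ Metric.ball (0 : E) r, Tendsto (fun N => q.partialSum N x) atTop (𝓝 (H x)))
    {f : E} (hf : f ∈ Metric.ball (0 : E) r) (n : ℕ) : p n (fun _ => f) = q n (fun _ => f) := by
  have h0 : Tendsto (fun n => q n (fun _ => f)) atTop (𝓝 0) := by
    have h1 := hq f hf
    have h2 := (h1.comp (tendsto_add_atTop_nat 1)).sub h1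
    rw [sub_self] at h2
    refine h2.congr fun N => ?_
    simp [FormalMultilinearSeries.partialSum, Finset.sum_range_succ]
  -- Bounded terms give the slice of `q` radius at least `1`, and uniqueness of one-variable power
  -- series applies.
  obtain ⟨M, hM⟩ := (Metric.isBounded_range_of_tendsto _ h0).exists_norm_le
  have hrad : ((1 : NNReal) : ENNReal) ≤ (q.slice f).radius :=
    (q.slice f).le_radius_of_bound M fun n => by
      rw [q.norm_slice]
      simpa using hM _ (Set.mem_range_self n)
  have hb := (q.slice f).hasFPowerSeriesOnBall (lt_of_lt_of_le (by simp) hrad)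
  have hb1 := hb.mono (r' := 1) (by simp) (by simpa using hrad)
  have hcongr : HasFPowerSeriesOnBall (fun z : ℂ => H (z • f)) (q.slice f) 0 1 := by
    refine hb1.congr fun z hz => ?_
    have hs := (hb1.hasSum hz).tendsto_sum_nat
    rw [zero_add] at hs
    refine tendsto_nhds_unique hs ?_
    have hz1 : ‖z‖ < 1 := by
      have hz' : ‖z‖ₑ < 1 := by simpa using hz
      rwa [← ofReal_norm, ENNReal.ofReal_lt_one] at hz'
    have hmem : z • f ∈ Metric.ball (0 : E) r := by
      rw [mem_ball_zero_iff] at hf ⊢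
      rw [norm_smul]
      exact (mul_le_of_le_one_left (norm_nonneg _) hz1.le).trans_lt hf
    simpa only [FormalMultilinearSeries.partialSum, FormalMultilinearSeries.slice_apply_diagonal]
      using hq _ hmem
  rw [hp.diagonal_eq_of_slice hcongr.hasFPowerSeriesAt, q.slice_apply_one]

end Taylor

/-! ### Passing the two hypotheses to the Taylor polynomials. -/

section Disjointness

theorem OrthogonallyAdditiveOn.diagonal_add {A B : Type*} [NonUnitalNormedRing A] [NormedSpace ℂ A]
    [IsScalarTower ℂ A A] [SMulCommClass ℂ A A] [NormedAddCommGroup B] [NormedSpace ℂ B]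
    {H : A → B} {p : FormalMultilinearSeries ℂ A B} {r : ℝ} (hr : 0 < r)
    (hadd : OrthogonallyAdditiveOn H (Metric.ball 0 r)) (hp : HasFPowerSeriesAt H p 0)
    {f g : A} (hfg : f * g = 0) (hgf : g * f = 0) (n : ℕ) :
    p n (fun _ => f + g) = p n (fun _ => f) + p n (fun _ => g) := by
  have h := ((hp.slice f).add (hp.slice g)).congr (g := fun z : ℂ => H (z • (f + g))) ?_
  · rw [hp.diagonal_eq_of_slice h]
    change p.slice f n (fun _ => 1) + p.slice g n (fun _ => 1) = _
    simp
  · filter_upwards [eventually_smul_mem_ball f hr, eventually_smul_mem_ball g hr,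
      eventually_smul_mem_ball (f + g) hr] with z hzf hzg hzfg
    have := hadd (z • f) hzf (z • g) hzg (by rwa [← smul_add])
      (by rw [smul_mul_smul_comm, hfg, smul_zero]) (by rw [smul_mul_smul_comm, hgf, smul_zero])
    rw [smul_add, this]
    rfl

variable {X Y : Type*} [TopologicalSpace X] [TopologicalSpace Y]

/-- If `H (w • g) y ≠ 0` for a single admissible `w`, then `H (z • f) y = 0` for all small `z`, so
every coefficient along `f` vanishes at `y`. This allows `n ≠ m`. -/
theorem ZeroProductPreservingOn.diagonal_mul_eq_zero {H : C₀(X, ℂ) → C₀(Y, ℂ)}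
    {p : FormalMultilinearSeries ℂ C₀(X, ℂ) C₀(Y, ℂ)} {r : ℝ} (hr : 0 < r)
    (hzero : ZeroProductPreservingOn H (Metric.ball 0 r)) (hp : HasFPowerSeriesAt H p 0)
    {f g : C₀(X, ℂ)} (hfg : f * g = 0) (n m : ℕ) (y : Y) :
    p n (fun _ => f) y * p m (fun _ => g) y = 0 := by
  have hslice : ∀ f : C₀(X, ℂ), (∀ᶠ z : ℂ in 𝓝 0, H (z • f) y = 0) →
      ∀ n, p n (fun _ => f) y = 0 := by
    intro f hf n
    obtain ⟨s, hs⟩ := hp.slice f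
    have h := (ZeroAtInftyContinuousMap.evalCLM y).comp_hasFPowerSeriesOnBall hs
    have h0 := h.hasFPowerSeriesAt.eq_zero_of_eventually hf
    have h1 := congrArg (fun q => q n (fun _ => 1)) h0
    rw [← p.slice_apply_one]
    exact h1
  by_cases hg : ∀ᶠ z : ℂ in 𝓝 0, H (z • g) y = 0
  · rw [hslice g hg, mul_zero]
  · obtain ⟨w, hw, hwm⟩ :=
      ((not_eventually.mp hg).and_eventually (eventually_smul_mem_ball g hr)).exists
    rw [hslice f ?_, zero_mul]
    filter_upwards [eventually_smul_mem_ball f hr] with z hz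
    have h := hzero (z • f) hz (w • g) hwm
      (by rw [smul_mul_smul_comm, hfg, smul_zero])
    have hy := DFunLike.congr_fun h y
    exact (mul_eq_zero.mp hy).resolve_right hw

end Disjointness

/-! ### Regularity of the weights and of the point map. -/

section WeightedPowers

variable {X Y : Type*} [TopologicalSpace X] [LocallyCompactSpace X] [T2Space X]
  [TopologicalSpace Y] {n : ℕ} {P : C₀(X, ℂ) → C₀(Y, ℂ)} {h : Y → ℂ} {φ : Y → X}

/-- For a bump `e` at `φ y` supported in `U`, `P e` stays nonzero near `y`, which forces `φ z ∈ U`.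
-/
theorem continuousAt_of_eq_mul_pow (hP : ∀ f y, P f y = h y * f (φ y) ^ n) (hn : n ≠ 0) {y : Y}
    (hy : h y ≠ 0) : ContinuousAt φ y := by
  intro U hU
  obtain ⟨e, he1, he0, -⟩ := ZeroAtInftyContinuousMap.exists_eventuallyEq_one hU
  have hPy : P e y ≠ 0 := by
    rw [hP, he1.self_of_nhds, one_pow, mul_one]
    exact hy
  rw [mem_map]
  filter_upwards [(map_continuous (P e)).continuousAt.eventually_ne hPy] with z hz
  by_contra hzU
  apply hz
  rw [hP, he0 _ hzU, zero_pow hn, mul_zero]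

/-- By continuity of `φ` at `y`, the weight agrees near `y` with `P e` for a function `e` equal to
`1` near `φ y`. -/
theorem continuousAt_weight_of_eq_mul_pow (hP : ∀ f y, P f y = h y * f (φ y) ^ n) (hn : n ≠ 0)
    {y : Y} (hy : h y ≠ 0) : ContinuousAt h y := by
  obtain ⟨e, he1, -, -⟩ :=
    ZeroAtInftyContinuousMap.exists_eventuallyEq_one (univ_mem : Set.univ ∈ 𝓝 (φ y))
  have hcont := (map_continuous (P e)).continuousAt (x := y)
  refine hcont.congr ?_
  filter_upwards [(continuousAt_of_eq_mul_pow hP hn hy).eventually he1] with z hz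
  rw [hP, hz, one_pow, mul_one]

theorem norm_weight_le_of_eq_mul_pow (hP : ∀ f y, P f y = h y * f (φ y) ^ n) {C : ℝ}
    (hC : ∀ f, ‖f‖ ≤ 1 → ‖P f‖ ≤ C) (y : Y) : ‖h y‖ ≤ C := by
  obtain ⟨e, he1, -, he⟩ :=
    ZeroAtInftyContinuousMap.exists_eventuallyEq_one (univ_mem : Set.univ ∈ 𝓝 (φ y))
  have h1 : P e y = h y := by rw [hP, he1.self_of_nhds, one_pow, mul_one]
  rw [← h1]
  exact ((P e).norm_apply_le y).trans (hC e he)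

end WeightedPowers

/-! ### Assembly of the representation and its convergence. -/

theorem mainTheorem2 {X Y : Type*}
    [TopologicalSpace X] [LocallyCompactSpace X] [T2Space X] [Nonempty X]
    [TopologicalSpace Y] [LocallyCompactSpace Y] [T2Space Y]
    (r : ℝ) (hr : 0 < r) (H : C₀(X, ℂ) → C₀(Y, ℂ))
    (hhol : AnalyticOnNhd ℂ H (Metric.ball 0 r))
    (hbdd : Bornology.IsBounded (H '' Metric.ball 0 r))
    (hadd : OrthogonallyAdditiveOn H (Metric.ball 0 r))
    (hzero : ZeroProductPreservingOn H (Metric.ball 0 r)) :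
    ∃ (h : ℕ → Y → ℂ) (φ : Y → X),
      (∀ n, 1 ≤ n → (∃ C : ℝ, ∀ y, ‖h n y‖ ≤ C) ∧
        IsOpen {y | h n y ≠ 0} ∧ ContinuousOn (h n) {y | h n y ≠ 0}) ∧
      (∀ n, 1 ≤ n → ∀ y, h n y ≠ 0 → ContinuousAt φ y) ∧
      (∀ f ∈ Metric.ball (0 : C₀(X, ℂ)) r, ∀ y : Y,
        HasSum (fun n : ℕ => h (n + 1) y * f (φ y) ^ (n + 1)) (H f y)) ∧
      (∀ ρ < r, TendstoUniformlyOn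
        (fun (N : ℕ) (q : C₀(X, ℂ) × Y) => ∑ n ∈ Finset.Icc 1 N, h n q.2 * q.1 (φ q.2) ^ n)
        (fun q => H q.1 q.2) atTop (Metric.ball 0 ρ ×ˢ Set.univ)) ∧
      (HasUniformTaylorSeriesOn H (Metric.ball 0 r) → TendstoUniformlyOn
        (fun (N : ℕ) (q : C₀(X, ℂ) × Y) => ∑ n ∈ Finset.Icc 1 N, h n q.2 * q.1 (φ q.2) ^ n)
        (fun q => H q.1 q.2) atTop (Metric.ball 0 r ×ˢ Set.univ)) := by
  have hmem0 : (0 : C₀(X, ℂ)) ∈ Metric.ball (0 : C₀(X, ℂ)) r := Metric.mem_ball_self hr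
  obtain ⟨p, hp⟩ := hhol 0 hmem0
  obtain ⟨C, hC⟩ := hbdd.exists_norm_le
  have hC' : ∀ f ∈ Metric.ball (0 : C₀(X, ℂ)) r, ‖H f‖ ≤ C := fun f hf =>
    hC _ (Set.mem_image_of_mem H hf)
  have hpoint : ∀ y : Y, ∃ (x : X) (c : ℕ → ℂ), ∀ n, ∀ f : C₀(X, ℂ),
      p n (fun _ => f) y = c n * f x ^ n := by
    intro y
    refine exists_diagonal_eq_mul_pow (A := fun n =>
      (ZeroAtInftyContinuousMap.evalCLM y).compContinuousMultilinearMap (p n)) ?_ ?_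
    · intro n f g hfg
      have h1 := hadd.diagonal_add hr hp hfg (by rw [mul_comm, hfg]) n
      exact DFunLike.congr_fun h1 y
    · intro n m f g hfg
      exact hzero.diagonal_mul_eq_zero hr hp hfg n m y
  choose φ h hφ using hpoint
  have hP : ∀ n, ∀ (f : C₀(X, ℂ)) (y : Y), p n (fun _ => f) y = h y n * f (φ y) ^ n :=
    fun n f y => hφ y n f
  -- Orthogonal additivity at `0 + 0` gives `H 0 = 0`, so the series starts in degree `1`.
  have hp0 : ∀ f : C₀(X, ℂ), p 0 (fun _ => f) = 0 := by
    intro f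
    have h1 := hadd 0 hmem0 0 hmem0 (by simpa using hr) (by simp) (by simp)
    rw [hp.coeff_zero]
    simpa using h1
  have hpart : ∀ N, ∀ (f : C₀(X, ℂ)) (y : Y),
      ∑ n ∈ Finset.range (N + 1), p n (fun _ => f) y =
        ∑ n ∈ Finset.Icc 1 N, h y n * f (φ y) ^ n := by
    intro N f y
    rw [Finset.range_eq_Ico, Finset.sum_eq_sum_Ico_succ_bot (by omega), hp0,
      ZeroAtInftyContinuousMap.zero_apply, zero_add]
    exact Finset.sum_congr rfl fun n _ => hP n f y
  have hcauchy : ∀ σ < r, 0 < σ → ∀ f : C₀(X, ℂ), ‖f‖ < σ →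
      HasSum (fun n => p n (fun _ => f)) (H f) ∧
        ∀ n, ‖p n (fun _ => f)‖ ≤ C * (r / σ)⁻¹ ^ n := by
    intro σ hσr hσ f hf
    refine hp.hasSum_and_norm_diagonal_le hhol hC' ((one_lt_div hσ).mpr hσr) ?_
    rw [div_mul_eq_mul_div, div_lt_iff₀ hσ]
    exact mul_lt_mul_of_pos_left hf hr
  have heval : ∀ f : C₀(X, ℂ), ‖f‖ < r → ∀ y,
      HasSum (fun n => p n (fun _ => f) y) (H f y) := by
    intro f hf y
    have hs := (hcauchy ((‖f‖ + r) / 2) (by linarith) (by positivity) f (by linarith)).1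
    exact (ZeroAtInftyContinuousMap.evalCLM y).hasSum hs
  have hshift : ∀ s : Set (C₀(X, ℂ) × Y), TendstoUniformlyOn
      (fun (N : ℕ) (q : C₀(X, ℂ) × Y) => ∑ n ∈ Finset.range N, p n (fun _ => q.1) q.2)
      (fun q => H q.1 q.2) atTop s → TendstoUniformlyOn
      (fun (N : ℕ) (q : C₀(X, ℂ) × Y) => ∑ n ∈ Finset.Icc 1 N, h q.2 n * q.1 (φ q.2) ^ n)
      (fun q => H q.1 q.2) atTop s := by
    intro s hs u hu
    filter_upwards [(tendsto_add_atTop_nat 1).eventually (hs u hu)] with N hN q hq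
    rw [← hpart]
    exact hN q hq
  refine ⟨fun n y => h y n, φ, fun n hn => ⟨⟨‖p n‖, ?_⟩, ?_, ?_⟩, fun n hn y hy => ?_,
    fun f hf y => ?_, fun ρ hρ => hshift _ ?_, fun ⟨q, hq⟩ => hshift _ ?_⟩
  · refine norm_weight_le_of_eq_mul_pow (hP n) fun f hf => ?_
    refine ((p n).le_opNorm _).trans (mul_le_of_le_one_right (norm_nonneg _) ?_)
    exact Finset.prod_le_one (fun _ _ => norm_nonneg _) fun _ _ => hf
  · rw [isOpen_iff_eventually]
    intro y hy
    exact (continuousAt_weight_of_eq_mul_pow (hP n) (by omega) hy).eventually_ne hy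
  · intro y hy
    exact (continuousAt_weight_of_eq_mul_pow (hP n) (by omega) hy).continuousWithinAt
  · exact continuousAt_of_eq_mul_pow (hP n) (by omega) hy
  · have hs := heval f (mem_ball_zero_iff.mp hf) y
    rw [← hasSum_nat_add_iff' 1, Finset.sum_range_one, hp0, ZeroAtInftyContinuousMap.zero_apply,
      sub_zero] at hs
    simpa only [hP] using hs
  -- The maximum with `r / 2` keeps the radius positive when `ρ ≤ 0`.
  · have hσ : 0 < max ρ (r / 2) := lt_max_of_lt_right (by positivity)
    have hσr : max ρ (r / 2) < r := max_lt hρ (by linarith)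
    have hfσ : ∀ q ∈ Metric.ball (0 : C₀(X, ℂ)) ρ ×ˢ (Set.univ : Set Y),
        ‖q.1‖ < max ρ (r / 2) := fun q hq =>
      (mem_ball_zero_iff.mp hq.1).trans_le (le_max_left _ _)
    have hsum : Summable fun n : ℕ => C * (r / max ρ (r / 2))⁻¹ ^ n :=
      (summable_geometric_of_lt_one (by positivity)
        (inv_lt_one_of_one_lt₀ ((one_lt_div hσ).mpr hσr))).mul_left C
    refine (tendstoUniformlyOn_tsum_nat hsum
      (f := fun n (q : C₀(X, ℂ) × Y) => p n (fun _ => q.1) q.2) fun n q hq => ?_).congr_right ?_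
    · exact ((p n fun _ => q.1).norm_apply_le q.2).trans
        ((hcauchy _ hσr hσ q.1 (hfσ q hq)).2 n)
    · intro q hq
      exact (heval q.1 ((hfσ q hq).trans hσr) q.2).tsum_eq
  · have hlim := fun f hf => hq.tendsto_at (x := f) hf
    rw [Metric.tendstoUniformlyOn_iff] at hq ⊢
    intro ε hε
    filter_upwards [hq ε hε] with N hN z hz
    -- The given series `q` need not equal `p`; agreement on diagonals is enough.
    have hpq : ∀ n, p n (fun _ => z.1) = q n (fun _ => z.1) :=
      hp.diagonal_eq_of_tendsto hlim hz.1
    have hpart' : ∑ n ∈ Finset.range N, p n (fun _ => z.1) z.2 = q.partialSum N z.1 z.2 := by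
      simp only [hpq]
      exact (map_sum (ZeroAtInftyContinuousMap.evalCLM z.2) _ _).symm
    rw [hpart', dist_eq_norm]
    refine lt_of_le_of_lt ?_ (hN z.1 hz.1)
    rw [dist_eq_norm]
    exact (H z.1 - q.partialSum N z.1).norm_apply_le z.2
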